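/- Let $G$ be an arbitrary group. For $x,y\in G$ write $x^y=y^{-1}xy$ and $[x,y]=x^{-1}y^{-1}xy$, and define $[x,_0 y]=x$ and $[x,_n y]=[[x,_{n-1}y],y]$ for $n\ge 1$. An element $x\in G$ is called a left $4$-Engel element of $G$ if $[g,_4 x]=1$ for all $g\in G$. If $a\in G$ is such that both $a$ and $a^{-1}$ are left $4$-Engel elements of $G$, then for every $b\in G$ the subgroup $\langle a,a^b\rangle$ of $G$ is nilpotent of class at most $4$. -/

import Mathlib

namespace EngelElements

variable {G : Type*} [Group G]

/-- The commutator `[a, b] = a⁻¹ b⁻¹ a b`. (Mathlib's `⁅a, b⁆` is `a b a⁻¹ b⁻¹` instead.) -/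
def comm (a b : G) : G := a⁻¹ * b⁻¹ * a * b

/-- The conjugate `a ^ b = b⁻¹ a b`. -/
def conj (a b : G) : G := b⁻¹ * a * b

/-- The `n`-Engel commutator `[a,ₙ b]`: `[a,₀ b] = a` and `[a,ₙ₊₁ b] = [[a,ₙ b], b]`. -/
def engelComm (a b : G) : ℕ → G
  | 0 => a
  | n + 1 => comm (engelComm a b n) b

/-- `L_n(G)`, the set of left `n`-Engel elements of `G`: those `x` with `[g,ₙ x] = 1` for all `g`. -/
def leftEngel (G : Type*) [Group G] (n : ℕ) : Set G :=
  {x | ∀ g : G, engelComm g x n = 1}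

end EngelElements

namespace EngelElements

variable {G : Type*} [Group G]

/-! Let `X` be the conjugacy class of `a`. The Engel conditions on `a` and `a⁻¹` give the two halves
of one statement: `⟨x, x^y⟩` has class at most 2 for all `x, y ∈ X` (`conjClassTwo_of_leftEngel`).

Put `c = [x,y]`, `A = [c,x]`, `B = [c,y]`. Class 2 makes `A` commute with `x, c` and `B` with `y,
c`. If `A` and `B` also commute, then `[A,y] = [B,x]` is central (`comm_comm_comm_central`), and
climbing the upper central series gives class at most 4.

The hard point is `[A,B] = 1` (`ConjClassTwo.commute_comm_comm`). It is extracted from the pair `p =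
c`, `q = c^y` acting on `x^y`, with `α = [p, x^y]` and `β = [q, x^y] = A^y`. Relations among the
conjugates of `βα⁻¹` by powers of `α` force `α` and `β` to commute (`CentralPair.commute_all`). -/

theorem conj_mul (a b g : G) : conj (a * b) g = conj a g * conj b g := by
  simp only [conj]; group

theorem conj_inv (a g : G) : conj a⁻¹ g = (conj a g)⁻¹ := by
  simp only [conj]; group

theorem conj_conj (a g h : G) : conj (conj a g) h = conj a (g * h) := by
  simp only [conj]; group

theorem conj_one (a : G) : conj a 1 = a := by
  simp [conj]

theorem conj_comm (a b g : G) : conj (comm a b) g = comm (conj a g) (conj b g) := by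
  simp only [conj, comm]; group

theorem mul_conj (a g : G) : g * conj a g = a * g := by
  simp only [conj]; group

theorem conj_eq_of_commute {a g : G} (h : Commute a g) : conj a g = a := by
  rw [conj, mul_assoc, h.eq, inv_mul_cancel_left]

theorem conj_injective (g : G) : Function.Injective fun a : G => conj a g := by
  intro a b h
  simpa [conj] using h

theorem commute_conj {a b : G} (h : Commute a b) (g : G) : Commute (conj a g) (conj b g) := by
  rw [commute_iff_eq, ← conj_mul, h.eq, conj_mul]

theorem commute_of_conj {a b g : G} (h : Commute (conj a g) (conj b g)) : Commute a b := by
  apply conj_injective g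
  simpa only [conj_mul] using h.eq

/-- Commuting `p`, `q` whose commutators with `x` are `α`, `β`, where `α` is central in `⟨p, x⟩`
and `β` is central in `⟨q, x⟩`. -/
structure CentralPair (p q x α β : G) : Prop where
  left : comm p x = α
  right : comm q x = β
  pq : Commute p q
  αp : Commute α p
  αx : Commute α x
  βq : Commute β q
  βx : Commute β x

/-! ### Relations in a central pair. -/

namespace CentralPair

variable {p q x α β : G}

theorem conj_x_p (H : CentralPair p q x α β) : conj x p = x * α⁻¹ := by
  rw [← H.left]; simp only [conj, comm]; group

theorem conj_x_q (H : CentralPair p q x α β) : conj x q = x * β⁻¹ := by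
  rw [← H.right]; simp only [conj, comm]; group

theorem comm_inv_inv {p x : G} (h₁ : Commute (comm p x) p) (h₂ : Commute (comm p x) x) :
    comm p⁻¹ x⁻¹ = comm p x := by
  have h : comm p⁻¹ x⁻¹ = conj (comm p x) (x⁻¹ * p⁻¹) := by
    simp only [conj, comm]; group
  rw [h, conj_eq_of_commute (h₂.inv_right.mul_right h₁.inv_right)]

theorem inv (H : CentralPair p q x α β) : CentralPair p⁻¹ q⁻¹ x⁻¹ α β where
  left := by
    obtain ⟨rfl, rfl, -, h₁, h₂, -, -⟩ := H
    exact comm_inv_inv h₁ h₂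
  right := by
    obtain ⟨rfl, rfl, -, -, -, h₁, h₂⟩ := H
    exact comm_inv_inv h₁ h₂
  pq := H.pq.inv_inv
  αp := H.αp.inv_right
  αx := H.αx.inv_right
  βq := H.βq.inv_right
  βx := H.βx.inv_right

/-- Expand `[qp, x] = [pq, x]` in both orders. -/
theorem cocycle (H : CentralPair p q x α β) : conj β p * α = conj α q * β := by
  have h₁ : conj β p * α = comm (q * p) x := by
    rw [← H.left, ← H.right]; simp only [conj, comm]; group
  have h₂ : conj α q * β = comm (p * q) x := by
    rw [← H.left, ← H.right]; simp only [conj, comm]; group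
  rw [h₁, h₂, H.pq.eq]

theorem commute_left (H : CentralPair p q x α β) : Commute (conj β p * α) (x * α⁻¹) := by
  refine Commute.mul_left ?_ (H.αx.mul_right (Commute.refl α).inv_right)
  rw [← H.conj_x_p]
  exact commute_conj H.βx p

theorem commute_right (H : CentralPair p q x α β) : Commute (conj β p * α) (x * β⁻¹) := by
  rw [H.cocycle]
  refine Commute.mul_left ?_ (H.βx.mul_right (Commute.refl β).inv_right)
  rw [← H.conj_x_q]
  exact commute_conj H.αx q

/-- `conj β p * α` centralizes `xα⁻¹` and `xβ⁻¹`, hence `βα⁻¹`. Conjugating by powers of `xα⁻¹` acts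
on `βα⁻¹` as powers of `α` do, because `x` commutes with `α` and `β`. -/
theorem commute_zpow_conj (H : CentralPair p q x α β) (k : ℤ) :
    Commute (conj β p * α) (conj (β * α⁻¹) (α ^ k)) := by
  have h₁ : Commute (conj β p * α) (β * α⁻¹) := by
    have h := (H.commute_right.inv_right).mul_right H.commute_left
    have e : (x * β⁻¹)⁻¹ * (x * α⁻¹) = β * α⁻¹ := by group
    rwa [e] at h
  have h₂ := commute_conj h₁ ((x * α⁻¹) ^ (-k))
  rw [conj_eq_of_commute (H.commute_left.zpow_right (-k))] at h₂
  have e : (x * α⁻¹) ^ (-k) = x ^ (-k) * α ^ k := by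
    rw [(H.αx.symm.inv_right).mul_zpow]; simp
  rwa [e, ← conj_conj, conj_eq_of_commute ((H.βx.mul_left H.αx.inv_left).zpow_right (-k))] at h₂

theorem square_relation (H : CentralPair p q x α β)
    (hz : Commute (q * x) (conj (x * q) α⁻¹)) :
    β * β * (conj β p * α) = conj β p * α * α⁻¹ * β * α * β := by
  set γ := conj β p with hγ
  set s := conj α q with hs
  have hsγ : s = γ * α * β⁻¹ := eq_mul_inv_of_mul_eq H.cocycle.symm
  have hγq : conj γ q = γ := by
    rw [hγ, conj_conj, H.pq.eq, ← conj_conj, conj_eq_of_commute H.βq]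
  have hβq : conj β q = β := conj_eq_of_commute H.βq
  have hsx : conj s x = conj s β := by
    have h : conj s (x * β⁻¹) = s := by
      rw [← H.conj_x_q]
      exact conj_eq_of_commute (commute_conj H.αx q)
    have h' := congrArg (fun t => conj t β) h
    simpa [conj_conj] using h'
  have hαz : conj α (x * q) = s := by
    rw [← conj_conj, conj_eq_of_commute H.αx]
  have hsz : conj s (x * q) = β⁻¹ * γ * s := by
    have h : conj s q = γ * s * β⁻¹ := by
      conv_lhs => rw [hsγ]
      rw [conj_mul, conj_mul, hγq, conj_inv, hβq]
    have h' : conj s (x * q) = conj (conj s q) β := by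
      rw [← conj_conj, hsx, conj_conj s β q, H.βq.eq, ← conj_conj]
    rw [h', h]; simp only [conj]; group
  set z := x * q with hzdef
  have e₁ : q * x = z * β := by rw [← H.right, hzdef]; simp only [comm]; group
  have e₂ : conj z α⁻¹ = z * s * α⁻¹ := by rw [← hαz]; simp only [conj]; group
  have e₃ : conj (z * s * α⁻¹) z = z * (β⁻¹ * γ * s) * s⁻¹ := by
    rw [conj_mul, conj_mul, hsz, conj_inv, hαz]; simp [conj]
  have e₄ : conj β z = β := by
    rw [hzdef, ← conj_conj, conj_eq_of_commute H.βx, hβq]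
  rw [e₁, e₂] at hz
  -- This is `hz` rewritten through `qx = zβ` and `z^(α⁻¹) = zsα⁻¹`, with the common factor `z²`
  -- cancelled.
  have key : β * s * α⁻¹ = β⁻¹ * γ * β := by
    have h := hz.eq
    have l : z * β * (z * s * α⁻¹) = z * (z * (conj β z * s * α⁻¹)) := by
      simp only [conj]; group
    have r : z * s * α⁻¹ * (z * β) = z * (conj (z * s * α⁻¹) z * β) := by
      simp only [conj]; group
    rw [l, r, e₃, e₄] at h
    have h' := mul_left_cancel h
    have : z * (β⁻¹ * γ * s) * s⁻¹ * β = z * (β⁻¹ * γ * β) := by group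
    rw [this] at h'
    exact mul_left_cancel h'
  calc β * β * (γ * α) = β * (β * s * α⁻¹) * α * β := by rw [hsγ]; group
    _ = _ := by rw [key]; group

theorem conj_inv_eq (H : CentralPair p q x α β) :
    conj β p⁻¹ = β * (conj β p * α)⁻¹ * β * α := by
  have hα : comm p⁻¹ x = α⁻¹ := by
    have h : comm p⁻¹ x = (conj (comm p x) p⁻¹)⁻¹ := by simp only [conj, comm]; group
    rw [h, H.left, conj_eq_of_commute H.αp.inv_right]
  have h₁ : conj β p⁻¹ * α⁻¹ = comm (q * p⁻¹) x := by
    rw [← hα, ← H.right]; simp only [conj, comm]; group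
  have h₂ : conj α⁻¹ q * β = comm (p⁻¹ * q) x := by
    rw [← hα, ← H.right]; simp only [conj, comm]; group
  have h₃ : conj β p⁻¹ * α⁻¹ = conj α⁻¹ q * β := by
    rw [h₁, h₂, H.pq.inv_left.eq]
  rw [H.cocycle]
  calc conj β p⁻¹ = conj β p⁻¹ * α⁻¹ * α := by group
    _ = _ := by rw [h₃, conj_inv]; group

end CentralPair

/-! ### Conjugates of one element by powers of another. -/

section Shift

variable {g α h k : G}

theorem conj_zpow_conj_zpow (g α : G) (m n : ℤ) :
    conj (conj g (α ^ m)) (α ^ n) = conj g (α ^ (m + n)) := by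
  rw [conj_conj, zpow_add]

/-- `hr` says that `V = h^(α⁻²)h⁻¹` is the conjugate of `g⁻¹g^α` by `u = g^(α⁻¹)`. Since `V`
centralizes every `g^(αⁿ)`, in particular `u`, this conjugation is trivial. -/
theorem shift_relation (hc : ∀ n : ℤ, Commute h (conj g (α ^ n)))
    (hr : g * α * (g * α) * h = h * α⁻¹ * (g * α) * α * (g * α)) :
    conj h (α ^ (-2 : ℤ)) = g⁻¹ * conj g α * h ∧
      ∀ n : ℤ, Commute (g⁻¹ * conj g α) (conj g (α ^ n)) := by
  set u := conj g (α ^ (-1 : ℤ)) with hu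
  set V := conj h (α ^ (-2 : ℤ)) * h⁻¹ with hV
  have hVc : ∀ n : ℤ, Commute V (conj g (α ^ n)) := by
    intro n
    refine Commute.mul_left ?_ (hc n).inv_left
    have := commute_conj (hc (n + 2)) (α ^ (-2 : ℤ))
    rwa [conj_zpow_conj_zpow, add_neg_cancel_right] at this
  have h1 : Commute h (conj g α) := by simpa using hc 1
  have e₁ : g * u * conj h (α ^ (-2 : ℤ)) = conj g α * u * h := by
    have l : g * u * conj h (α ^ (-2 : ℤ)) = (g * α * (g * α) * h) * (α ^ (-2 : ℤ)) := by
      rw [hu]; simp only [conj]; group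
    have r : h * α⁻¹ * (g * α) * α * (g * α) * α ^ (-2 : ℤ) = h * (conj g α * u) := by
      rw [hu]; simp only [conj]; group
    rw [l, hr, r, (h1.mul_right (hc (-1))).eq]
  have e₂ : V = u⁻¹ * (g⁻¹ * conj g α) * u := by
    rw [hV]
    calc conj h (α ^ (-2 : ℤ)) * h⁻¹
        = u⁻¹ * g⁻¹ * (g * u * conj h (α ^ (-2 : ℤ))) * h⁻¹ := by group
      _ = _ := by rw [e₁]; group
  have e₃ : V = g⁻¹ * conj g α := by
    have h' := (hVc (-1)).eq
    rw [← hu] at h'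
    have : u * V = (g⁻¹ * conj g α) * u := by rw [e₂]; group
    rw [this] at h'
    exact mul_right_cancel h'
  rw [← e₃]
  exact ⟨by rw [hV]; group, hVc⟩

/-- Write `c n = g^(αⁿ)`. Each quotient `(c m)⁻¹ c (m+1)` centralizes all `c n`, so commuting with
`c n` passes between `c m` and `c (m+1)`; start from `m = n`. -/
theorem commute_zpow_shift (hV : ∀ n : ℤ, Commute (g⁻¹ * conj g α) (conj g (α ^ n))) (m n : ℤ) :
    Commute (conj g (α ^ m)) (conj g (α ^ n)) := by
  have step : ∀ m n : ℤ, Commute (conj g (α ^ m))⁻¹ (conj g (α ^ n)) ↔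
      Commute (conj g (α ^ (m + 1)))⁻¹ (conj g (α ^ n)) := by
    intro m n
    have h := commute_conj (hV (n - m)) (α ^ m)
    rw [conj_zpow_conj_zpow, sub_add_cancel, conj_mul, conj_inv] at h
    have e : conj (conj g α) (α ^ m) = conj g (α ^ (m + 1)) := by
      rw [conj_conj, ← zpow_one_add, add_comm]
    rw [e] at h
    constructor
    · intro h'
      have h2 := h'.inv_left.mul_left h
      simpa using h2
    · intro h'
      have h2 := h.mul_left h'
      simpa using h2
  have all : ∀ j : ℤ, Commute (conj g (α ^ (n + j)))⁻¹ (conj g (α ^ n)) := by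
    intro j
    induction j with
    | zero => simp
    | succ i ih =>
      rw [← add_assoc]
      exact (step _ n).1 ih
    | pred i ih =>
      refine (step _ n).2 ?_
      have e : n + (-(i : ℤ) - 1) + 1 = n + -(i : ℤ) := by ring
      rwa [e]
  have := (all (m - n)).inv_left
  simpa using this

/-- The link `hkh` between `h` and `k` expresses `α⁴` through elements centralizing `g`, so `c n =
g^(αⁿ)` has period 4. Computing `k^(α⁻²)` in two ways then reduces the period to 2. -/
theorem commute_sq_of_shift (hh : ∀ n : ℤ, Commute h (conj g (α ^ n)))
    (hk : ∀ n : ℤ, Commute k (conj g (α ^ n)))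
    (hhr : g * α * (g * α) * h = h * α⁻¹ * (g * α) * α * (g * α))
    (hkr : g * α * (g * α) * k = k * α⁻¹ * (g * α) * α * (g * α))
    (hkh : k = g * α * h⁻¹ * (g * α) * α * α) : Commute g (α ^ (2 : ℤ)) := by
  obtain ⟨h₁, hV⟩ := shift_relation hh hhr
  obtain ⟨k₁, -⟩ := shift_relation hk hkr
  set c : ℤ → G := fun n => conj g (α ^ n) with hc
  have cc : ∀ m n, Commute (c m) (c n) := commute_zpow_shift hV
  have c0 : c 0 = g := by simp [hc, conj]
  have c1 : c 1 = conj g α := by simp [hc]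
  have cshift : ∀ m n, conj (c m) (α ^ n) = c (m + n) := conj_zpow_conj_zpow g α
  set h' := conj h (α ^ (-1 : ℤ)) with hh'
  have hc' : ∀ n, Commute h' (c n) := by
    intro n
    have := commute_conj (hh (n + 1)) (α ^ (-1 : ℤ))
    rwa [conj_zpow_conj_zpow, add_neg_cancel_right] at this
  have hk' : k = c 0 * h'⁻¹ * c (-1) * α ^ (4 : ℤ) := by
    have hα : α ^ (4 : ℤ) = α * α * α * α := by
      rw [zpow_ofNat]; simp only [pow_succ, pow_zero, one_mul]
    rw [hkh, c0, hh', hc, hα]; simp only [conj, zpow_neg, zpow_one]; group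
  have h4 : Commute (α ^ (4 : ℤ)) g := by
    have := hk 0
    change Commute k (c 0) at this
    have e : α ^ (4 : ℤ) = (c 0 * h'⁻¹ * c (-1))⁻¹ * k := by rw [hk']; group
    rw [← c0, e]
    exact ((((cc 0 0).mul_left (hc' 0).inv_left).mul_left (cc (-1) 0)).inv_left).mul_left this
  have per : c (-3) = c 1 := by
    have : c 1 = conj (conj g (α ^ (4 : ℤ))) (α ^ (-3 : ℤ)) := by
      rw [conj_zpow_conj_zpow]; rfl
    rw [this, conj_eq_of_commute h4.symm]
  have h3 : conj h' (α ^ (-2 : ℤ)) = (c (-1))⁻¹ * c 0 * h' := by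
    rw [hh', conj_conj, ← zpow_add, add_comm, zpow_add, ← conj_conj, h₁, ← c1, conj_mul, conj_mul,
      conj_inv, cshift, ← c0, cshift]
    rfl
  have e : c (-2) * (h'⁻¹ * ((c 0)⁻¹ * c (-1))) * c 1
      = (c 0)⁻¹ * c 1 * c 0 * (h'⁻¹ * c (-1)) := by
    have l : conj k (α ^ (-2 : ℤ))
        = c (-2) * (h'⁻¹ * ((c 0)⁻¹ * c (-1))) * c 1 * α ^ (4 : ℤ) := by
      have hα : conj (α ^ (4 : ℤ)) (α ^ (-2 : ℤ)) = α ^ (4 : ℤ) :=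
        conj_eq_of_commute ((Commute.refl α).zpow_zpow _ _)
      rw [hk', conj_mul, conj_mul, conj_mul, conj_inv, cshift, cshift, h3, hα]
      rw [show (0 : ℤ) + -2 = -2 from rfl, show (-1 : ℤ) + -2 = -3 from rfl, per]
      simp only [mul_inv_rev, inv_inv, mul_assoc]
    have r : g⁻¹ * conj g α * k = (c 0)⁻¹ * c 1 * c 0 * (h'⁻¹ * c (-1)) * α ^ (4 : ℤ) := by
      rw [hk', ← c1, c0]; group
    rw [l, r] at k₁
    exact mul_right_cancel k₁
  have e2 : c (-2) = c 0 := by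
    have x1 : Commute h'⁻¹ ((c 0)⁻¹ * c (-1) * c 1) :=
      (((hc' 0).inv_right.mul_right (hc' (-1))).mul_right (hc' 1)).inv_left
    have x2 : Commute h'⁻¹ (c (-1)) := (hc' (-1)).inv_left
    have x3 : c (-2) * ((c 0)⁻¹ * c (-1) * c 1) * h'⁻¹ = (c 0)⁻¹ * c 1 * c 0 * c (-1) * h'⁻¹ := by
      rw [mul_assoc (c (-2)), ← x1.eq, mul_assoc _ (c (-1)) h'⁻¹, ← x2.eq, ← e]; group
    have x4 := mul_right_cancel x3
    have x5 : (c 0)⁻¹ * c 1 * c 0 * c (-1) = c 1 * c (-1) := by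
      rw [mul_assoc (c 0)⁻¹, (cc 1 0).eq]; group
    have x6 : (c 0)⁻¹ * c (-1) * c 1 = (c 0)⁻¹ * (c 1 * c (-1)) := by
      rw [mul_assoc, (cc (-1) 1).eq]
    rw [x5, x6, ← mul_assoc] at x4
    have x7 := mul_eq_right.1 x4
    exact mul_inv_eq_one.1 x7
  have := congrArg (fun t => conj t (α ^ (2 : ℤ))) e2
  simp only [cshift] at this
  norm_num at this
  have h2 : conj g (α ^ (2 : ℤ)) = g := by
    rw [c0] at this
    exact this.symm
  have h5 := mul_conj g (α ^ (2 : ℤ))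
  rw [h2] at h5
  exact h5.symm

end Shift

/-! ### Commutation of `α` and `β`. -/

namespace CentralPair

variable {p q x α β : G}

theorem commute_all (H : CentralPair p q x α β)
    (hz : Commute (q * x) (conj (x * q) α⁻¹)) (hz' : Commute (q * x) (conj (x * q) α)) :
    Commute α β ∧ Commute (conj β p * α) α ∧ Commute (conj β p * α) β ∧
      Commute (conj β p * α) x := by
  set g := β * α⁻¹ with hg
  have hβ : β = g * α := by rw [hg]; group
  set h := conj β p * α with hh
  set k := conj β p⁻¹ * α with hk
  -- Conjugating `hz'` by `α⁻¹` and inverting gives the hypothesis of `square_relation` for the pair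
  -- `H.inv`.
  have hzi : Commute (q⁻¹ * x⁻¹) (conj (x⁻¹ * q⁻¹) α⁻¹) := by
    have h1 := (commute_conj hz' α⁻¹).inv_inv.symm
    rw [conj_conj, mul_inv_cancel, ← conj_inv] at h1
    simpa [conj, mul_assoc] using h1
  have r₁ := H.square_relation hz
  have r₂ := H.inv.square_relation hzi
  rw [← hh] at r₁
  rw [← hk] at r₂
  have hkh : k = β * h⁻¹ * β * α * α := by rw [hk, H.conj_inv_eq]
  have ch := H.commute_zpow_conj
  have hcg : Commute h g := by simpa [conj, hg, hh] using ch 0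
  have g2 : Commute g (α ^ (2 : ℤ)) := by
    refine commute_sq_of_shift ch H.inv.commute_zpow_conj ?_ ?_ ?_
    · rw [← hβ]; exact r₁
    · rw [← hβ]; exact r₂
    · rw [← hβ]; exact hkh
  have hαp : conj α p = α := conj_eq_of_commute H.αp
  have he : h = conj g p * α ^ (2 : ℤ) := by
    rw [hh, hβ, conj_mul, hαp, zpow_two, mul_assoc]
  have eα : Commute (conj g p) (α ^ (2 : ℤ)) := by
    have h1 := commute_conj g2 p
    rwa [conj_eq_of_commute (H.αp.zpow_left 2)] at h1
  -- Now `h = g^p α²` commutes with `α²`, so `shift_relation` collapses to `g^α = g`.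
  have gα : Commute g α := by
    rw [hβ] at r₁
    have h1 := (shift_relation ch r₁).1
    have h2 : Commute h (α ^ (-2 : ℤ)) := by
      rw [he, zpow_neg]
      exact (eα.mul_left (Commute.refl _)).inv_right
    rw [conj_eq_of_commute h2, ← hg] at h1
    have h4 : conj g α = g := (inv_mul_eq_one.1 (mul_eq_right.1 h1.symm)).symm
    have h5 := mul_conj g α
    rw [h4] at h5
    exact h5.symm
  have hα : Commute h α := by
    have h1 := commute_conj gα p
    rw [hαp] at h1
    rw [he]
    exact h1.mul_left ((Commute.refl α).zpow_left 2)
  refine ⟨?_, hα, ?_, ?_⟩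
  · rw [hβ]; exact gα.symm.mul_right (Commute.refl α)
  · rw [hβ]; exact hcg.mul_right hα
  · have h1 := H.commute_left.mul_right hα
    simpa using h1

theorem commute_comm_shift (H : CentralPair p q x α β)
    (hz : Commute (q * x) (conj (x * q) α⁻¹)) (hz' : Commute (q * x) (conj (x * q) α)) :
    Commute x (comm (q * p⁻¹ * q) (x * q)) := by
  obtain ⟨hαβ, hhα, hhβ, hhx⟩ := H.commute_all hz hz'
  have hα : comm p⁻¹ x = α⁻¹ := by
    have h : comm p⁻¹ x = (conj (comm p x) p⁻¹)⁻¹ := by simp only [conj, comm]; group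
    rw [h, H.left, conj_eq_of_commute H.αp.inv_right]
  have hββ : comm (q * q) x = β * β := by
    have h : comm (q * q) x = conj (comm q x) q * comm q x := by simp only [conj, comm]; group
    rw [h, H.right, conj_eq_of_commute H.βq]
  have e₁ : q * p⁻¹ * q = q * q * p⁻¹ := by
    rw [mul_assoc, mul_assoc, H.pq.inv_left.eq]
  have e₂ : comm (q * p⁻¹ * q) (x * q) = conj (conj (β * β) p⁻¹ * α⁻¹) q := by
    have h : Commute (q * p⁻¹ * q) q :=
      ((Commute.refl q).mul_left H.pq.inv_left).mul_left (Commute.refl q)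
    have h1 : comm (q * p⁻¹ * q) (x * q)
        = comm (q * p⁻¹ * q) q * conj (comm (q * p⁻¹ * q) x) q := by
      simp only [conj, comm]; group
    have h2 : comm (q * p⁻¹ * q) q = 1 := by
      rw [comm, mul_assoc, h.eq]; group
    have h3 : comm (q * q * p⁻¹) x = conj (comm (q * q) x) p⁻¹ * comm p⁻¹ x := by
      simp only [conj, comm]; group
    rw [h1, h2, one_mul, e₁, h3, hα, hββ]
  have e₃ : x = conj (x * β) q := by
    rw [conj_mul, H.conj_x_q, conj_eq_of_commute H.βq]; group
  rw [e₂]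
  nth_rewrite 1 [e₃]
  refine commute_conj ?_ q
  have d : ∀ t, Commute t α → Commute t β → Commute t (conj β p * α) →
      Commute t (conj (β * β) p⁻¹ * α⁻¹) := by
    intro t t₁ t₂ t₃
    have t₄ : Commute t (conj β p⁻¹) := by
      rw [H.conj_inv_eq]
      exact ((t₂.mul_right t₃.inv_right).mul_right t₂).mul_right t₁
    rw [conj_mul]
    exact (t₄.mul_right t₄).mul_right t₁.inv_right
  exact (d x H.αx.symm H.βx.symm hhx.symm).mul_left
    (d β hαβ.symm (Commute.refl β) hhβ.symm)

end CentralPair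

/-- `u` and `v` commute with their commutator, i.e. `⟨u, v⟩` is nilpotent of class at most `2`. -/
def CommutesWithComm (u v : G) : Prop :=
  Commute u (comm u v) ∧ Commute v (comm u v)

theorem comm_inv_symm (u v : G) : (comm u v)⁻¹ = comm v u := by
  simp only [comm]; group

theorem mul_comm_eq_conj (u v : G) : u * comm u v = conj u v := by
  simp only [comm, conj]; group

theorem commutesWithComm_iff {u v : G} :
    CommutesWithComm u v ↔ Commute u (conj u v) ∧ Commute v (conj v u) := by
  have e₁ : comm u v = u⁻¹ * conj u v := by rw [← mul_comm_eq_conj]; group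
  have e₂ : comm u v = (conj v u)⁻¹ * v := by simp only [comm, conj]; group
  constructor
  · rintro ⟨h₁, h₂⟩
    rw [← mul_comm_eq_conj, ← mul_comm_eq_conj, ← comm_inv_symm u v]
    exact ⟨(Commute.refl u).mul_right h₁, (Commute.refl v).mul_right h₂.inv_right⟩
  · rintro ⟨h₁, h₂⟩
    exact ⟨e₁ ▸ (Commute.refl u).inv_right.mul_right h₁,
      e₂ ▸ h₂.inv_right.mul_right (Commute.refl v)⟩

/-! ### Classes of elements with `⟨x, x^y⟩` of class at most 2. -/

namespace CommutesWithComm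

variable {u v : G}

protected theorem symm (h : CommutesWithComm u v) : CommutesWithComm v u := by
  rw [CommutesWithComm, ← comm_inv_symm]
  exact ⟨h.2.inv_right, h.1.inv_right⟩

theorem comm_inv_mul (h : CommutesWithComm u v) : comm (u⁻¹ * v) v = comm v u := by
  have e : comm (u⁻¹ * v) v = conj (comm u v)⁻¹ (u⁻¹ * v) := by
    simp only [comm, conj]; group
  rw [e, conj_eq_of_commute, comm_inv_symm]
  exact (h.1.inv_left.mul_left h.2).symm.inv_left

end CommutesWithComm

theorem commute_conj_of_commutesWithComm {x z δ s : G} (hs : Commute s (x * δ))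
    (h : CommutesWithComm (x * δ) (conj z s)) : Commute (conj z x) (conj z δ⁻¹) := by
  have h₁ := commute_conj (commutesWithComm_iff.1 h).2 (s⁻¹ * δ⁻¹)
  have e : s * (x * δ * (s⁻¹ * δ⁻¹)) = x := by
    have := hs.eq
    calc s * (x * δ * (s⁻¹ * δ⁻¹)) = s * (x * δ) * s⁻¹ * δ⁻¹ := by group
      _ = x := by rw [this]; group
  rw [conj_conj, conj_conj, conj_conj, e, mul_inv_cancel_left] at h₁
  exact h₁.symm

/-- A set closed under conjugation such that `⟨x, x ^ y⟩` is nilpotent of class at most `2`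
for all its elements `x` and `y`. -/
structure ConjClassTwo (X : Set G) : Prop where
  conj_mem : ∀ x ∈ X, ∀ g, conj x g ∈ X
  commutes : ∀ x ∈ X, ∀ y ∈ X, CommutesWithComm x (conj x y)

namespace ConjClassTwo

variable {X : Set G} {x y : G}

/-- `[x,y] = (y^x)⁻¹y` lies in `⟨y, y^x⟩`, of class at most 2, and `[[x,y],y] = [y, y^x]` is central
there. -/
theorem commute_comm_comm_right (H : ConjClassTwo X) (hx : x ∈ X) (hy : y ∈ X) :
    Commute (comm (comm x y) y) y ∧ Commute (comm (comm x y) y) (comm x y) := by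
  have h := (H.commutes y hy x hx).symm
  have e : comm x y = (conj y x)⁻¹ * y := by simp only [comm, conj]; group
  have e' : comm (comm x y) y = comm y (conj y x) := by rw [e, h.comm_inv_mul]
  rw [e', e]
  exact ⟨h.symm.1.symm, h.symm.2.symm.inv_right.mul_right h.symm.1.symm⟩

theorem commute_comm_comm_left (H : ConjClassTwo X) (hx : x ∈ X) (hy : y ∈ X) :
    Commute (comm (comm x y) x) x ∧ Commute (comm (comm x y) x) (comm x y) := by
  have h := H.commutes x hx y hy
  have e : comm x y = x⁻¹ * conj x y := by simp only [comm, conj]; group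
  have e' : comm (comm x y) x = comm (conj x y) x := by
    simp only [comm, conj]; group
  rw [e', e]
  exact ⟨h.symm.2.symm, h.symm.2.symm.inv_right.mul_right h.symm.1.symm⟩

theorem centralPair (H : ConjClassTwo X) (hx : x ∈ X) (hy : y ∈ X) :
    CentralPair (comm x y) (conj (comm x y) y) (conj x y)
      (comm (conj x y) x) (conj (comm (comm x y) x) y) := by
  have h := H.commutes x hx y hy
  have e : comm x y = x⁻¹ * conj x y := by simp only [comm, conj]; group
  obtain ⟨l₁, l₂⟩ := H.commute_comm_comm_left hx hy
  obtain ⟨r₁, r₂⟩ := H.commute_comm_comm_right hx hy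
  refine ⟨?_, ?_, ?_, ?_, h.symm.1.symm, commute_conj l₂ y, commute_conj l₁ y⟩
  · rw [e, h.comm_inv_mul]
  · rw [conj_comm (comm x y) x y]
  · rw [← mul_comm_eq_conj]
    exact (Commute.refl _).mul_right r₂.symm
  · rw [e]
    exact h.symm.2.symm.inv_right.mul_right h.symm.1.symm

theorem commute_comm_comm (H : ConjClassTwo X) (hx : x ∈ X) (hy : y ∈ X) :
    Commute (comm (comm x y) x) (comm (comm x y) y) := by
  have P := H.centralPair hx hy
  obtain ⟨r₁, r₂⟩ := H.commute_comm_comm_right hx hy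
  have h := H.commutes x hx y hy
  set p := comm x y with hp
  set q := conj p y with hq
  set x₁ := conj x y with hx₁
  have hx₁X : x₁ ∈ X := H.conj_mem x hx y
  have hp' : p = x⁻¹ * x₁ := by rw [hp, hx₁]; simp only [comm, conj]; group
  have hx₂ : x₁ * q = conj x₁ y := by
    rw [hx₁, ← mul_comm_eq_conj x y, conj_mul, ← hp, ← hq, mul_comm_eq_conj]
  have hqx : q * x₁ = conj (conj x₁ y) x₁ := by
    rw [← hx₂]; simp only [conj]; group
  -- `x₁α = x₁^x` is again in `X`, so the class 2 condition applies to it and its conjugate by `y`;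
  -- `z₂` uses `x₁α⁻¹ = x₁^(x⁻¹)` in the same way.
  have z₁ : Commute (q * x₁) (conj (x₁ * q) (comm x₁ x)⁻¹) := by
    rw [hqx, hx₂]
    have w : x₁ * comm x₁ x = conj x₁ x := mul_comm_eq_conj x₁ x
    refine commute_conj_of_commutesWithComm (s := x₁) ?_ ?_
    · exact (Commute.refl x₁).mul_right P.αx.symm
    · have e : conj (conj x₁ y) x₁ = conj (x₁ * comm x₁ x) y := by
        rw [w, hx₁]; simp only [conj]; group
      rw [e, w]
      exact H.commutes _ (H.conj_mem _ hx₁X x) y hy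
  have z₂ : Commute (q * x₁) (conj (x₁ * q) (comm x₁ x)) := by
    rw [hqx, hx₂]
    have w : x₁ * (comm x₁ x)⁻¹ = conj x₁ x⁻¹ := by
      have h₁ := congrArg (fun t => conj t x⁻¹) (mul_comm_eq_conj x₁ x)
      simp only [conj_mul, conj_conj, mul_inv_cancel, conj_one] at h₁
      rw [conj_eq_of_commute h.symm.2.symm.inv_right] at h₁
      exact (eq_mul_inv_of_mul_eq h₁).symm
    have := commute_conj_of_commutesWithComm (x := x₁) (z := conj x₁ y)
      (δ := (comm x₁ x)⁻¹) (s := x₁⁻¹) ?_ ?_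
    · rwa [inv_inv] at this
    · exact ((Commute.refl x₁).mul_right P.αx.symm.inv_right).inv_left
    · have e : conj (conj x₁ y) x₁⁻¹ = conj (x₁ * (comm x₁ x)⁻¹) y := by
        rw [w, conj_conj, conj_conj, hx₁]; simp only [conj]; group
      rw [e, w]
      exact H.commutes _ (H.conj_mem _ hx₁X x⁻¹) y hy
  have hB : comm p y = p⁻¹ * q := by rw [hq]; simp only [comm, conj]; group
  have hq' : conj q y = q * p⁻¹ * q := by
    have h₁ : conj (p⁻¹ * q) y = p⁻¹ * q := by
      rw [← hB]; exact conj_eq_of_commute r₁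
    rw [conj_mul, conj_inv, ← hq] at h₁
    calc conj q y = q * (q⁻¹ * conj q y) := by group
      _ = _ := by rw [h₁]; group
  -- As `qp⁻¹q = q^y` and `x₁q = x₁^y`, the commutator here is `[q,x₁]^y = β^y`. Undoing the
  -- conjugation by `y` shows that `x` commutes with `β`; then so do `p = x⁻¹x₁` and `B = p⁻¹q`.
  have key := P.commute_comm_shift z₁ z₂
  rw [← hq', hx₂, ← conj_comm, P.right] at key
  have hβx : Commute x (conj (comm p x) y) := commute_of_conj key
  have hβp : Commute (conj (comm p x) y) p := by
    have h₁ := hβx.symm.inv_right.mul_right P.βx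
    rwa [← hp'] at h₁
  refine commute_of_conj (g := y) ?_
  rw [conj_eq_of_commute r₁, hB]
  exact hβp.inv_right.mul_right P.βq

end ConjClassTwo

/-! ### From commuting `A`, `B` to class at most 4. -/

theorem comm_comm_comm_central {x y : G}
    (hx : Commute (comm (comm x y) x) x) (hxc : Commute (comm (comm x y) x) (comm x y))
    (hy : Commute (comm (comm x y) y) y) (hyc : Commute (comm (comm x y) y) (comm x y))
    (hxy : Commute (comm (comm x y) x) (comm (comm x y) y)) :
    comm (comm (comm x y) x) y = comm (comm (comm x y) y) x ∧
      Commute (comm (comm (comm x y) x) y) x ∧ Commute (comm (comm (comm x y) x) y) y := by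
  set c := comm x y with hc
  set A := comm c x with hA
  set B := comm c y with hB
  have cy : conj c y⁻¹ = c * B⁻¹ := by
    have h := congrArg (fun t => conj t y⁻¹) (mul_comm_eq_conj c y)
    simp only [conj_mul, conj_conj, mul_inv_cancel, conj_one] at h
    rw [← hB, conj_eq_of_commute hy.inv_right] at h
    exact eq_mul_inv_of_mul_eq h
  have cx : conj c x⁻¹ = c * A⁻¹ := by
    have h := congrArg (fun t => conj t x⁻¹) (mul_comm_eq_conj c x)
    simp only [conj_mul, conj_conj, mul_inv_cancel, conj_one] at h
    rw [← hA, conj_eq_of_commute hx.inv_right] at h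
    exact eq_mul_inv_of_mul_eq h
  have xy : conj x y⁻¹ = x * (conj c y⁻¹)⁻¹ := by
    rw [hc]; simp only [conj, comm]; group
  have yx : conj y x⁻¹ = y * conj c x⁻¹ := by
    rw [hc]; simp only [conj, comm]; group
  have back : ∀ s t g : G, Commute s (conj t g⁻¹) → Commute (conj s g) t := by
    intro s t g h
    have := commute_conj h g
    rwa [conj_conj t, inv_mul_cancel, conj_one] at this
  have Acy : Commute A (conj c y⁻¹) := cy ▸ hxc.mul_right hxy.inv_right
  have Bcx : Commute B (conj c x⁻¹) := cx ▸ hyc.mul_right hxy.symm.inv_right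
  -- `A` centralizes `x`, `c` and `B`, hence `x^(y⁻¹) = x(cB⁻¹)⁻¹`; conjugate by `y`.
  have Ayx : Commute (conj A y) x := back A x y (xy ▸ hx.mul_right Acy.inv_right)
  have Bxy : Commute (conj B x) y := back B y x (yx ▸ hy.mul_right Bcx)
  have Bxc : Commute (conj B x) c := back B c x Bcx
  have eA : comm A y = A⁻¹ * conj A y := by simp only [comm, conj]; group
  have eB : comm B x = B⁻¹ * conj B x := by simp only [comm, conj]; group
  have hcB : Commute c (comm B x) := eB ▸ hyc.symm.inv_right.mul_right Bxc.symm
  have hAy : conj A y = A * comm B x := by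
    have h₁ : conj A y = comm (c * B) (x * c) := by
      rw [hA, conj_comm, hB, mul_comm_eq_conj, hc, mul_comm_eq_conj]
    have h₂ : comm (c * B) (x * c) = comm (c * B) c * conj (comm (c * B) x) c := by
      simp only [comm, conj]; group
    have h₃ : comm (c * B) c = 1 := by
      rw [comm, mul_assoc, ((Commute.refl c).mul_left hyc).eq]; group
    have h₄ : comm (c * B) x = conj A B * comm B x := by
      rw [hA]; simp only [comm, conj]; group
    rw [h₁, h₂, h₃, one_mul, h₄, conj_eq_of_commute hxy, conj_mul, conj_eq_of_commute hxc,
      conj_eq_of_commute hcB.symm]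
  have e : comm A y = comm B x := by rw [eA, hAy, inv_mul_cancel_left]
  refine ⟨e, ?_, ?_⟩
  · rw [eA]; exact hx.inv_left.mul_left Ayx
  · rw [e, eB]; exact hy.inv_left.mul_left Bxy

theorem mem_upperCentralSeries_succ_of_closure {S : Set G} (hS : Subgroup.closure S = ⊤)
    {n : ℕ} {g : G} (h : ∀ s ∈ S, comm g s ∈ Subgroup.upperCentralSeries G n) :
    g ∈ Subgroup.upperCentralSeries G (n + 1) := by
  let π := QuotientGroup.mk' (Subgroup.upperCentralSeries G n)
  have key : ∀ s, comm g s ∈ Subgroup.upperCentralSeries G n ↔ Commute (π s) (π g) := by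
    intro s
    rw [← QuotientGroup.eq_one_iff]
    change π (comm g s) = 1 ↔ _
    simp only [comm, map_mul, map_inv]
    rw [mul_assoc, ← mul_inv_rev, inv_mul_eq_one]
    rfl
  have hle : Subgroup.closure S ≤ (Subgroup.centralizer {π g}).comap π := by
    rw [Subgroup.closure_le]
    intro s hs
    exact Subgroup.mem_centralizer_singleton_iff.2 ((key s).1 (h s hs)).eq
  rw [Subgroup.mem_upperCentralSeries_succ_iff]
  intro s
  have hs : s⁻¹ ∈ (Subgroup.centralizer {π g}).comap π := hle (hS ▸ Subgroup.mem_top _)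
  have h1 : Commute (π s⁻¹) (π g) := Subgroup.mem_centralizer_singleton_iff.1 hs
  rw [map_inv] at h1
  have h2 := (key s).2 (by simpa using h1.inv_left)
  rw [← QuotientGroup.eq_one_iff]
  change π _ = 1
  have h3 : Commute (π g) (π s) := by simpa using h1.inv_left.symm
  rw [map_commutatorElement, commutatorElement_eq_one_iff_commute]
  exact h3

theorem upperCentralSeries_four_eq_top {x y : G} (hG : Subgroup.closure {x, y} = ⊤)
    (hx : Commute (comm (comm x y) x) x) (hxc : Commute (comm (comm x y) x) (comm x y))
    (hy : Commute (comm (comm x y) y) y) (hyc : Commute (comm (comm x y) y) (comm x y))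
    (hxy : Commute (comm (comm x y) x) (comm (comm x y) y)) :
    Subgroup.upperCentralSeries G 4 = ⊤ := by
  obtain ⟨e, dx, dy⟩ := comm_comm_comm_central hx hxc hy hyc hxy
  have one : ∀ {a b : G}, Commute a b → comm a b = 1 := by
    intro a b h
    rw [comm, mul_assoc, h.eq]; group
  have step : ∀ {n : ℕ} {g : G}, comm g x ∈ Subgroup.upperCentralSeries G n →
      comm g y ∈ Subgroup.upperCentralSeries G n → g ∈ Subgroup.upperCentralSeries G (n + 1) := by
    intro n g h₁ h₂
    refine mem_upperCentralSeries_succ_of_closure hG ?_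
    rintro s (rfl | rfl) <;> assumption
  have c₁ : comm (comm (comm x y) x) y ∈ Subgroup.upperCentralSeries G 1 :=
    step (one dx ▸ Subgroup.one_mem _) (one dy ▸ Subgroup.one_mem _)
  have c₂ : comm (comm x y) x ∈ Subgroup.upperCentralSeries G 2 :=
    step (one hx ▸ Subgroup.one_mem _) c₁
  have c₂' : comm (comm x y) y ∈ Subgroup.upperCentralSeries G 2 :=
    step (e ▸ c₁) (one hy ▸ Subgroup.one_mem _)
  have c₃ : comm x y ∈ Subgroup.upperCentralSeries G 3 := step c₂ c₂'
  have c₄ : x ∈ Subgroup.upperCentralSeries G 4 :=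
    step (one (Commute.refl x) ▸ Subgroup.one_mem _) c₃
  have c₄' : y ∈ Subgroup.upperCentralSeries G 4 :=
    step (comm_inv_symm x y ▸ Subgroup.inv_mem _ c₃) (one (Commute.refl y) ▸ Subgroup.one_mem _)
  rw [eq_top_iff, ← hG, Subgroup.closure_le]
  rintro s (rfl | rfl) <;> assumption

/-! ### From the Engel conditions to class 2. -/

theorem engelComm_conj (g x h : G) (n : ℕ) :
    engelComm (conj g h) (conj x h) n = conj (engelComm g x n) h := by
  induction n with
  | zero => rfl
  | succ n ih => rw [engelComm, engelComm, ih, conj_comm]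

theorem conj_mem_leftEngel {x : G} {n : ℕ} (hx : x ∈ leftEngel G n) (h : G) :
    conj x h ∈ leftEngel G n := by
  intro g
  have e : g = conj (conj g h⁻¹) h := by simp only [conj]; group
  rw [e, engelComm_conj, hx]
  simp [conj]

/-- `[g,₃ x]` is a conjugate of `x⁻¹` times `x`. The fourth commutator being trivial makes that
conjugate commute with `x`. -/
theorem commute_conj_of_mem_leftEngel {x : G} (hx : x ∈ leftEngel G 4) (g : G) :
    Commute (conj x (conj x⁻¹ (conj x g)⁻¹)) x := by
  set w := conj x⁻¹ (conj x g)⁻¹ with hw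
  have e : engelComm g x 3 = conj (conj x w)⁻¹ (x * x) * x := by
    rw [hw]; simp only [engelComm, comm, conj]; group
  have h : comm (engelComm g x 3) x = 1 := hx g
  have h₁ : Commute (engelComm g x 3) x := by
    rw [comm, mul_assoc, ← mul_inv_rev, inv_mul_eq_one] at h
    exact h.symm
  have h₂ : Commute (conj (conj x w)⁻¹ (x * x)) (conj x (x * x)) := by
    have h₃ : conj (conj x w)⁻¹ (x * x) = engelComm g x 3 * x⁻¹ := by rw [e]; group
    rw [h₃, conj_eq_of_commute ((Commute.refl x).mul_right (Commute.refl x))]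
    exact h₁.mul_left (Commute.refl x).inv_left
  simpa using (commute_of_conj h₂).inv_left

/-- With `y = x^g`, the condition on `x⁻¹` makes `x` commute with `x^(x^y)`, and the condition on
`x` makes `x^y` commute with `(x^y)^x`. -/
theorem commutesWithComm_conj {x : G} (hx : x ∈ leftEngel G 4) (hx' : x⁻¹ ∈ leftEngel G 4)
    (g : G) : CommutesWithComm x (conj x (conj x g)) := by
  rw [commutesWithComm_iff]
  constructor
  · have h := (commute_conj_of_mem_leftEngel hx' g).inv_inv.symm
    rw [← conj_inv] at h
    simpa [conj_inv] using h
  · have h := commute_conj (commute_conj_of_mem_leftEngel hx g) (conj x g)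
    have e : conj (conj x (conj x⁻¹ (conj x g)⁻¹)) (conj x g)
        = conj (conj x (conj x g)) x⁻¹ := by
      generalize conj x g = y
      simp only [conj]; group
    have h₁ := commute_conj (e ▸ h) x
    rwa [conj_conj _ x⁻¹, inv_mul_cancel, conj_one] at h₁

theorem conjClassTwo_of_leftEngel {a : G} (ha : a ∈ leftEngel G 4) (ha' : a⁻¹ ∈ leftEngel G 4) :
    ConjClassTwo (Set.range (conj a)) where
  conj_mem := by
    rintro _ ⟨s, rfl⟩ g
    exact ⟨s * g, (conj_conj a s g).symm⟩
  commutes := by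
    rintro _ ⟨s, rfl⟩ _ ⟨t, rfl⟩
    have e : conj a t = conj (conj a s) (s⁻¹ * t) := by rw [conj_conj, mul_inv_cancel_left]
    rw [e]
    refine commutesWithComm_conj (conj_mem_leftEngel ha s) ?_ _
    rw [← conj_inv]
    exact conj_mem_leftEngel ha' s

end EngelElements

open EngelElements in
theorem theorem1p5 {G : Type*} [Group G] (a : G)
    (ha : a ∈ EngelElements.leftEngel G 4)
    (ha_inv : a⁻¹ ∈ EngelElements.leftEngel G 4) (b : G) :
    Group.IsNilpotent (Subgroup.closure {a, EngelElements.conj a b} : Subgroup G) ∧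
      Group.nilpotencyClass (Subgroup.closure {a, EngelElements.conj a b} : Subgroup G) ≤ 4 := by
  have H := conjClassTwo_of_leftEngel ha ha_inv
  have hx : a ∈ Set.range (conj a) := ⟨1, by simp [conj]⟩
  have hy : conj a b ∈ Set.range (conj a) := ⟨b, rfl⟩
  obtain ⟨l₁, l₂⟩ := H.commute_comm_comm_left hx hy
  obtain ⟨r₁, r₂⟩ := H.commute_comm_comm_right hx hy
  have lr := H.commute_comm_comm hx hy
  have top : Subgroup.upperCentralSeries (Subgroup.closure {a, conj a b} : Subgroup G) 4 = ⊤ := by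
    refine upperCentralSeries_four_eq_top
      (x := ⟨a, Subgroup.subset_closure (by simp)⟩)
      (y := ⟨conj a b, Subgroup.subset_closure (by simp)⟩) ?_
      (Subtype.ext l₁) (Subtype.ext l₂) (Subtype.ext r₁) (Subtype.ext r₂) (Subtype.ext lr)
    rw [← Subgroup.closure_closure_coe_preimage (k := {a, conj a b})]
    congr 1
    ext ⟨s, hs⟩
    simp
  have : Group.IsNilpotent (Subgroup.closure {a, conj a b} : Subgroup G) := ⟨4, top⟩
  exact ⟨this, Subgroup.upperCentralSeries_eq_top_iff_nilpotencyClass_le.1 top⟩
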